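/- Let $\gamma\colon[a,b]\to\mathbf{R}^3$ ($a<b$) be a rectifiable curve, that is, a continuous map of finite length, with $\gamma(t)\neq 0$ for all $t$. Write $L$ for length, defined as the supremum of the lengths of inscribed polygons. Put $\overline\gamma:=\gamma/|\gamma|$ and $\theta_\gamma(t):=L(\overline\gamma|_{[a,t]})$, and let the (cone) unfolding of $\gamma$ be the planar curve $\tilde\gamma\colon[a,b]\to\mathbf{R}^2$ given by $$\tilde\gamma(t):=|\gamma(t)|\,\bigl(\cos\theta_\gamma(t),\,\sin\theta_\gamma(t)\bigr).$$ For a rectifiable curve $\beta\colon[a,b]\to\mathbf{R}^3$ let $$H(\beta):=\int_{p\in\mathbf{S}^2}\#\beta^{-1}(T_p\mathbf{S}^2)\,dp,\qquad E(\beta):=\frac{H(\beta)}{L(\beta)}$$ be its horizon and its efficiency, where $dp$ is surface area on the unit sphere, $T_p\mathbf{S}^2=\{x\in\mathbf{R}^3:\langle x-p,p\rangle=0\}$ is the plane tangent to the sphere at $p$, and the quotient is read as $0$ when $L(\beta)=0$ (in which case $H(\beta)=0$ as well). The efficiency of a planar curve is that of the same curve in $\mathbf{R}^2=\mathbf{R}^2\times\{0\}\subset\mathbf{R}^3$.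 Then $\tilde\gamma$ is a rectifiable curve with the same height and arclength as $\gamma$, that is, $|\tilde\gamma(t)|=|\gamma(t)|$ for all $t\in[a,b]$ and $L(\tilde\gamma|_{[s,t]})=L(\gamma|_{[s,t]})$ whenever $a\le s\le t\le b$, and it has the same efficiency: $$E(\gamma)=E(\tilde\gamma).$$ -/

import Mathlib

open MeasureTheory Set
open scoped ENNReal

namespace ConeUnfolding

/-- Euclidean 3-space. -/
abbrev Space := EuclideanSpace ℝ (Fin 3)

/-- The Euclidean plane. -/
abbrev Plane := EuclideanSpace ℝ (Fin 2)

/-- The standard inclusion of the plane in 3-space as the first two coordinates. -/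
def planeInclusion (x : Plane) : Space := !₂[x 0, x 1, 0]

/-- The length of `γ` restricted to `[a, b]`: the supremum over all partitions of the length of
the inscribed polygon. -/
noncomputable def length {E : Type*} [PseudoEMetricSpace E] (a b : ℝ) (γ : ℝ → E) : ℝ≥0∞ :=
  eVariationOn γ (Icc a b)

/-- `γ` restricted to `[a, b]` is a rectifiable curve: `a < b`, the map is continuous on `[a, b]`,
and it has finite length there. Values outside `[a, b]` play no role. -/
structure IsRectifiableCurve {E : Type*} [PseudoEMetricSpace E] (a b : ℝ) (γ : ℝ → E) : Prop where
  lt : a < b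
  continuousOn : ContinuousOn γ (Icc a b)
  length_ne_top : length a b γ ≠ ∞

/-- The plane in 3-space that is tangent to the unit sphere at the point `p` of the sphere. -/
def tangentPlane (p : Metric.sphere (0 : Space) 1) : Set Space :=
  {x | inner ℝ (x - (p : Space)) (p : Space) = 0}

/-- The horizon of `γ : [a, b] → ℝ³`: the integral over the unit sphere, with respect to surface
area, of the number of parameters `t ∈ [a, b]` for which `γ t` lies in the tangent plane. -/
noncomputable def horizon (a b : ℝ) (γ : ℝ → Space) : ℝ≥0∞ :=
  ∫⁻ p : Metric.sphere (0 : Space) 1,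
    (({t ∈ Icc a b | γ t ∈ tangentPlane p}.encard : ℕ∞) : ℝ≥0∞)
      ∂(volume : Measure Space).toSphere

/-- The efficiency of `γ : [a, b] → ℝ³`: horizon divided by length. -/
noncomputable def efficiency (a b : ℝ) (γ : ℝ → Space) : ℝ≥0∞ :=
  horizon a b γ / length a b γ

/-- The radial projection `γ / |γ|` of `γ` to the unit sphere. -/
noncomputable def radialProjection (γ : ℝ → Space) (t : ℝ) : Space :=
  ‖γ t‖⁻¹ • γ t

/-- The cone angle of `γ` at time `t`: the length of `γ / |γ|` on `[a, t]`. -/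
noncomputable def coneAngle (a : ℝ) (γ : ℝ → Space) (t : ℝ) : ℝ :=
  (length a t (radialProjection γ)).toReal

/-- The cone unfolding of `γ`, a planar curve with the distance to the origin of `γ` and with the
cone angle of `γ` as its polar angle. -/
noncomputable def unfolding (a : ℝ) (γ : ℝ → Space) (t : ℝ) : Plane :=
  !₂[‖γ t‖ * Real.cos (coneAngle a γ t), ‖γ t‖ * Real.sin (coneAngle a γ t)]

end ConeUnfolding

open Filter Topology

namespace ConeUnfolding

/-! Length and horizon are both limits of sums over the edges of polygons inscribed at uniform
partitions. An edge from `x` to `y` contributes `‖x - y‖` to the length and the area of `separators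
x y` to the horizon. Both contributions are invariant under linear isometries, so they depend only
on `‖x‖`, `‖y‖` and the angle between `x` and `y`. Rolling the triangle with vertices `0`, `x`, `y`
into the plane changes neither.

The unfolding keeps the norms but turns by the length of the radial projection over the subinterval
instead of by the angle. Changing the angle by `δ` moves an endpoint by at most `‖y‖ * δ`. This
changes the edge length by at most that much and the separator area by at most a constant times that
much, because zones of the sphere have area at most proportional to their width
(`exists_surface_slab_le`). The sum of the `δ` tends to zero (`tendsto_sum_abs_angle_sub`): an angle
differs from its chord by a cubic term, and chords of the projected curve sum up to its length in
the limit. Hence lengths agree (`length_unfolding`) and horizons agree (`horizon_unfolding`).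

That polygons compute the horizon of a merely rectifiable curve is
`IsRectifiableCurve.tendsto_sum_surface_separators`. The Banach indicatrix formula turns the horizon
into a limit of areas of sets of tangent planes hitting subarcs. A plane that hits a subarc without
separating its endpoints passes close to one of them, because the subarc lies in a thin ellipsoid
with these endpoints as foci. Cauchy–Schwarz makes the total error vanish. -/

/-- Surface area on the unit sphere. -/
noncomputable abbrev surface : Measure (Metric.sphere (0 : Space) 1) :=
  (volume : Measure Space).toSphere

/-! ### Isometry invariance of spherical area. -/

/-- Two reflections suffice: one takes `x` to `x'`, the next takes the image of `y` to `y'`. The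
second fixes `x'`, since equality of the inner products makes `x'` orthogonal to its reflecting
vector. -/
theorem exists_linearIsometryEquiv_map_eq_map_eq {E : Type*} [NormedAddCommGroup E]
    [InnerProductSpace ℝ E] {x y x' y' : E} (hx : ‖x‖ = ‖x'‖) (hy : ‖y‖ = ‖y'‖)
    (hxy : inner ℝ x y = inner ℝ x' y') : ∃ Q : E ≃ₗᵢ[ℝ] E, Q x = x' ∧ Q y = y' := by
  let Q₁ : E ≃ₗᵢ[ℝ] E := (ℝ ∙ (x - x'))ᗮ.reflection
  have h₁ : Q₁ x = x' := Submodule.reflection_sub hx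
  let Q₂ : E ≃ₗᵢ[ℝ] E := (ℝ ∙ (Q₁ y - y'))ᗮ.reflection
  have h₂ : Q₂ (Q₁ y) = y' := Submodule.reflection_sub (by rw [Q₁.norm_map, hy])
  have h₃ : Q₂ x' = x' := by
    apply Submodule.reflection_mem_subspace_eq_self
    rw [Submodule.mem_orthogonal_singleton_iff_inner_left, inner_sub_right, ← hxy, ← h₁,
      Q₁.inner_map_map, sub_self]
  exact ⟨Q₁.trans Q₂, by simp [h₁, h₃], by simp [h₂]⟩

/-- Rewriting the area as the volume of the solid cone over the set, cut off at the unit ball,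
reduces spherical estimates to Lebesgue measure; the factor is the dimension. -/
theorem surface_setOf_mem {U : Set Space} (hU : MeasurableSet U) :
    surface {p | (p : Space) ∈ U} =
      3 * volume {q : Space | 0 < ‖q‖ ∧ ‖q‖ < 1 ∧ ‖q‖⁻¹ • q ∈ U} := by
  refine (Measure.toSphere_apply' _ (measurable_subtype_coe hU)).trans ?_
  congr 1
  · simp
  congr 1
  ext q
  simp only [Set.mem_smul, mem_Ioo, mem_image, mem_ofPred_eq]
  constructor
  · rintro ⟨r, ⟨hr0, hr1⟩, _, ⟨p, hp, rfl⟩, rfl⟩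
    have hn : ‖r • (p : Space)‖ = r := by
      rw [norm_smul, norm_eq_of_mem_sphere, mul_one, Real.norm_of_nonneg hr0.le]
    rw [hn, smul_smul, inv_mul_cancel₀ hr0.ne', one_smul]
    exact ⟨hr0, hr1, hp⟩
  · rintro ⟨h0, h1, hU⟩
    refine ⟨‖q‖, ⟨h0, h1⟩, ‖q‖⁻¹ • q, ⟨⟨‖q‖⁻¹ • q, ?_⟩, hU, rfl⟩, ?_⟩
    · rw [mem_sphere_zero_iff_norm, norm_smul, norm_inv, norm_norm, inv_mul_cancel₀ h0.ne']
    · rw [smul_smul, mul_inv_cancel₀ h0.ne', one_smul]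

theorem surface_setOf_map_mem (Q : Space ≃ₗᵢ[ℝ] Space) {U : Set Space} (hU : MeasurableSet U) :
    surface {p | Q (p : Space) ∈ U} = surface {p | (p : Space) ∈ U} := by
  have hQ : MeasurableSet (Q ⁻¹' U) := Q.continuous.measurable hU
  rw [surface_setOf_mem hU]
  refine (surface_setOf_mem hQ).trans ?_
  congr 1
  have hm : MeasurableSet {q : Space | 0 < ‖q‖ ∧ ‖q‖ < 1 ∧ ‖q‖⁻¹ • q ∈ U} := by
    apply (measurableSet_lt measurable_const measurable_norm).inter
    apply (measurableSet_lt measurable_norm measurable_const).inter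
    exact (measurable_norm.inv.smul measurable_id) hU
  rw [← Q.measurePreserving.measure_preimage hm.nullMeasurableSet]
  congr 1
  ext q
  simp [Q.norm_map]

/-! ### Separating planes and planes near a point. -/

/-- The set of points of the sphere whose tangent plane separates `x` from `y` (weakly), that is,
meets the segment between them. -/
def separators (x y : Space) : Set (Metric.sphere (0 : Space) 1) :=
  {p | (inner ℝ x (p : Space) - 1) * (inner ℝ y (p : Space) - 1) ≤ 0}

/-- The set of points of the sphere whose tangent plane has distance at most `w` from `x`. -/
def slab (x : Space) (w : ℝ) : Set (Metric.sphere (0 : Space) 1) :=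
  {p | |inner ℝ x (p : Space) - 1| ≤ w}

theorem surface_separators_congr {x y x' y' : Space} (hx : ‖x‖ = ‖x'‖) (hy : ‖y‖ = ‖y'‖)
    (hxy : inner ℝ x y = inner ℝ x' y') :
    surface (separators x y) = surface (separators x' y') := by
  obtain ⟨Q, rfl, rfl⟩ := exists_linearIsometryEquiv_map_eq_map_eq hx hy hxy
  have hU : MeasurableSet {q : Space | (inner ℝ (Q x) q - 1) * (inner ℝ (Q y) q - 1) ≤ 0} :=
    (isClosed_le (by fun_prop) continuous_const).measurableSet
  refine Eq.trans ?_ (surface_setOf_map_mem Q hU)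
  simp [separators]

theorem surface_slab_congr {x x' : Space} (hx : ‖x‖ = ‖x'‖) (w : ℝ) :
    surface (slab x w) = surface (slab x' w) := by
  obtain ⟨Q, rfl, -⟩ := exists_linearIsometryEquiv_map_eq_map_eq hx hx
    (by rw [real_inner_self_eq_norm_sq, real_inner_self_eq_norm_sq, hx])
  have hU : MeasurableSet {q : Space | |inner ℝ (Q x) q - 1| ≤ w} :=
    (isClosed_le (by fun_prop) continuous_const).measurableSet
  refine Eq.trans ?_ (surface_setOf_map_mem Q hU)
  simp [slab]

/-- Replacing `y` by `y'` changes `inner ℝ y p - 1` by at most `‖y - y'‖`, so its sign can be lost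
only where the new value is that small. -/
theorem separators_subset (x y y' : Space) :
    separators x y ⊆ separators x y' ∪ slab y' ‖y - y'‖ := by
  intro p hp
  simp only [separators, slab, mem_union, mem_ofPred_eq] at *
  by_contra! h
  obtain ⟨h1, h2⟩ := h
  have h3 : |(inner ℝ y (p : Space) - 1) - (inner ℝ y' (p : Space) - 1)| ≤ ‖y - y'‖ := by
    rw [sub_sub_sub_cancel_right, ← inner_sub_left]
    simpa using abs_real_inner_le_norm (y - y') (p : Space)
  generalize inner ℝ y (p : Space) - 1 = v at *
  generalize inner ℝ y' (p : Space) - 1 = v' at *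
  generalize inner ℝ x (p : Space) - 1 = u at *
  rw [abs_le] at h3
  rcases le_total 0 v' with h | h
  · rw [abs_of_nonneg h] at h2
    nlinarith
  · rw [abs_of_nonpos h] at h2
    nlinarith

/-! ### Area of zones of the sphere. -/

/-- The solid circular cone about the last axis, truncated at height one, whose slope has
square `c`. -/
def cone (c : ℝ) : Set Space := {q | 0 < q 2 ∧ q 2 ≤ 1 ∧ q 0 ^ 2 + q 1 ^ 2 ≤ c * q 2 ^ 2}

theorem measurableSet_cone (c : ℝ) : MeasurableSet (cone c) := by
  have h (i : Fin 3) : Measurable fun q : Space => q i := by fun_prop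
  exact (measurableSet_lt measurable_const (h 2)).inter
    ((measurableSet_le (h 2) measurable_const).inter
      (measurableSet_le (((h 0).pow_const 2).add ((h 1).pow_const 2))
        (((h 2).pow_const 2).const_mul c)))

/-- The diagonal map with entries `√c, √c, 1` carries `cone 1` onto `cone c` and has determinant
`c`. For `c = 0` the map is singular and preimages are found by hand. -/
theorem volume_cone {c : ℝ} (hc : 0 ≤ c) :
    volume (cone c) = ENNReal.ofReal c * volume (cone 1) := by
  let A : Matrix (Fin 3) (Fin 3) ℝ := Matrix.diagonal ![√c, √c, 1]
  let f : Space →ₗ[ℝ] Space := Matrix.toEuclideanLin A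
  have hdet : LinearMap.det f = c := by
    simp only [f, Matrix.toLpLin_eq_toLin, LinearMap.det_toLin]
    simp [A, Fin.prod_univ_three, Real.mul_self_sqrt hc]
  have hf (q : Space) (i : Fin 3) : f q i = (![√c, √c, 1] : Fin 3 → ℝ) i * q i := by
    simp [f, A, Matrix.mulVec_diagonal]
  have himage : cone c = f '' cone 1 := by
    ext q
    constructor
    · rintro ⟨h0, h1, h2⟩
      rcases hc.eq_or_lt with rfl | hc'
      · have h3 : q 0 = 0 := by nlinarith [sq_nonneg (q 0), sq_nonneg (q 1)]
        have h4 : q 1 = 0 := by nlinarith [sq_nonneg (q 0), sq_nonneg (q 1)]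
        refine ⟨q, ⟨h0, h1, by rw [h3, h4]; nlinarith⟩, ?_⟩
        ext i
        fin_cases i <;> simp [hf, h3, h4]
      · have hs : √c ≠ 0 := (Real.sqrt_pos.2 hc').ne'
        refine ⟨!₂[q 0 / √c, q 1 / √c, q 2], ⟨by simpa using h0, by simpa using h1, ?_⟩, ?_⟩
        · simp only [Matrix.cons_val, div_pow, Real.sq_sqrt hc]
          rw [← add_div, div_le_iff₀ hc']
          linarith
        · ext i
          fin_cases i <;> simp [hf, mul_div_cancel₀ _ hs]
    · rintro ⟨q, ⟨h0, h1, h2⟩, rfl⟩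
      refine ⟨by simpa [hf] using h0, by simpa [hf] using h1, ?_⟩
      simp only [hf, Matrix.cons_val, mul_pow, Real.sq_sqrt hc]
      nlinarith
  rw [himage, Measure.addHaar_image_linearMap, hdet, abs_of_nonneg hc]

theorem volume_cone_one_ne_top : volume (cone 1) ≠ ∞ := by
  refine ((measure_mono ?_).trans_lt
    (measure_closedBall_lt_top (x := (0 : Space)) (r := 2))).ne
  rintro q ⟨h0, h1, h2⟩
  rw [mem_closedBall_zero_iff, EuclideanSpace.norm_eq, Real.sqrt_le_left (by norm_num)]
  simp only [Fin.sum_univ_three, Real.norm_eq_abs, sq_abs]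
  nlinarith

theorem volume_cone_diff_le {c₁ c₂ : ℝ} (h : c₂ ≤ c₁) :
    volume (cone c₁ \ cone c₂) ≤ ENNReal.ofReal (c₁ - c₂) * volume (cone 1) := by
  rcases lt_or_ge c₁ 0 with h1 | h1
  · have : cone c₁ = ∅ := by
      ext q
      simp only [cone, mem_ofPred_eq, mem_empty_iff_false, iff_false, not_and, not_le]
      intro h0 _
      nlinarith [sq_nonneg (q 0), sq_nonneg (q 1), pow_pos h0 2]
    simp [this]
  rcases lt_or_ge c₂ 0 with h2 | h2
  · calc volume (cone c₁ \ cone c₂) ≤ volume (cone c₁) := measure_mono sdiff_subset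
      _ = ENNReal.ofReal c₁ * volume (cone 1) := volume_cone h1
      _ ≤ _ := by gcongr; linarith
  have hsub : cone c₂ ⊆ cone c₁ := fun q ⟨h0, h1, h2⟩ =>
    ⟨h0, h1, h2.trans (by gcongr)⟩
  have hfin : volume (cone c₂) ≠ ∞ := by
    rw [volume_cone h2]
    exact ENNReal.mul_ne_top ENNReal.ofReal_ne_top volume_cone_one_ne_top
  rw [measure_sdiff hsub (measurableSet_cone c₂).nullMeasurableSet hfin, volume_cone h1,
    volume_cone h2, ENNReal.ofReal_sub _ h2, ENNReal.sub_mul]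
  exact fun _ _ => volume_cone_one_ne_top

theorem surface_slab_le_of_le_half {x : Space} {w : ℝ} (hw : 0 < w) (hw' : w ≤ 1 / 2) :
    surface (slab x w) ≤ 3 * (ENNReal.ofReal (30 * w * ‖x‖ ^ 2) * volume (cone 1)) := by
  set r := ‖x‖ with hr
  have hr0 : 0 ≤ r := norm_nonneg x
  have hx : ‖x‖ = ‖(!₂[0, 0, r] : Space)‖ := by
    simp [EuclideanSpace.norm_eq, Fin.sum_univ_three, hr]
  rw [surface_slab_congr hx]
  have hU : MeasurableSet {q : Space | |inner ℝ (!₂[0, 0, r] : Space) q - 1| ≤ w} :=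
    (isClosed_le (by fun_prop) continuous_const).measurableSet
  refine (surface_setOf_mem hU).trans_le ?_
  gcongr
  have hw1 : 0 < 1 - w := by linarith
  have hw2 : 0 < 1 + 2 * w := by linarith
  -- With `x` on the last axis, the slab is bounded by two circular cones, and `r * q 2 = k * ‖q‖`
  -- is the cone of squared slope `r ^ 2 / k ^ 2 - 1`. Taking `k = 1 + 2 * w` instead of `1 + w`
  -- makes the inequality strict, so that the closed inner cone can be removed.
  have hc : r ^ 2 / (1 + 2 * w) ^ 2 - 1 ≤ r ^ 2 / (1 - w) ^ 2 - 1 := by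
    gcongr; linarith
  refine ((measure_mono ?_).trans (volume_cone_diff_le hc)).trans ?_
  · rintro q ⟨h0, h1, h2⟩
    have hq : ‖q‖ ^ 2 = q 0 ^ 2 + q 1 ^ 2 + q 2 ^ 2 := by
      rw [EuclideanSpace.norm_sq_eq]
      simp [Fin.sum_univ_three]
    have h3 : |r * q 2 / ‖q‖ - 1| ≤ w := by
      simp only [mem_ofPred_eq] at h2
      convert h2 using 3
      simp [PiLp.inner_apply, Fin.sum_univ_three]
      ring
    rw [abs_le] at h3
    have h4 : (1 - w) * ‖q‖ ≤ r * q 2 := by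
      rw [← le_div_iff₀ h0]; linarith
    have h5 : r * q 2 < (1 + 2 * w) * ‖q‖ := by
      rw [← div_lt_iff₀ h0]; linarith
    have h6 : 0 < r * q 2 := by nlinarith
    have h7 : 0 < q 2 := pos_of_mul_pos_right h6 hr0
    refine ⟨⟨h7, ?_, ?_⟩, ?_⟩
    · nlinarith [sq_nonneg (q 0), sq_nonneg (q 1)]
    · have h8 : ((1 - w) * ‖q‖) ^ 2 ≤ (r * q 2) ^ 2 := by gcongr
      have h9 : ‖q‖ ^ 2 ≤ r ^ 2 / (1 - w) ^ 2 * q 2 ^ 2 := by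
        rw [div_mul_eq_mul_div, le_div_iff₀ (by positivity)]
        linarith
      linarith
    · rintro ⟨-, -, h8⟩
      have h9 : (r * q 2) ^ 2 < ((1 + 2 * w) * ‖q‖) ^ 2 := by gcongr
      have h10 : r ^ 2 / (1 + 2 * w) ^ 2 * q 2 ^ 2 < ‖q‖ ^ 2 := by
        rw [div_mul_eq_mul_div, div_lt_iff₀ (by positivity)]
        linarith
      linarith
  · gcongr
    have h1 : r ^ 2 / (1 - w) ^ 2 - 1 - (r ^ 2 / (1 + 2 * w) ^ 2 - 1) =
        (3 * w * (2 + w) * r ^ 2) / ((1 - w) ^ 2 * (1 + 2 * w) ^ 2) := by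
      field_simp
      ring
    rw [h1, div_le_iff₀ (by positivity)]
    -- The numerator is at most `3 * w * (5 / 2) * r ^ 2` and the denominator at least `1 / 4`,
    -- whence the factor 30.
    have h2 : 1 / 2 ≤ (1 - w) * (1 + 2 * w) := by nlinarith
    have h3 : 1 / 4 ≤ (1 - w) ^ 2 * (1 + 2 * w) ^ 2 := by
      rw [← mul_pow]; nlinarith
    have h4 : 0 ≤ w * r ^ 2 := by positivity
    nlinarith

/-- Zones of the sphere have an area at most proportional to their height. -/
theorem exists_surface_slab_le (M : ℝ) : ∃ K : ℝ≥0∞, K ≠ ∞ ∧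
    ∀ x : Space, ‖x‖ ≤ M → ∀ w : ℝ, 0 ≤ w → surface (slab x w) ≤ K * ENNReal.ofReal w := by
  refine ⟨2 * surface univ + 3 * (ENNReal.ofReal (30 * M ^ 2) * volume (cone 1)), ?_, ?_⟩
  · exact ENNReal.add_ne_top.2 ⟨ENNReal.mul_ne_top (by simp) (measure_ne_top _ _),
      ENNReal.mul_ne_top (by simp) (ENNReal.mul_ne_top ENNReal.ofReal_ne_top volume_cone_one_ne_top)⟩
  intro x hx
  set K := 2 * surface univ + 3 * (ENNReal.ofReal (30 * M ^ 2) * volume (cone 1)) with hK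
  have hpos (w : ℝ) (hw : 0 < w) : surface (slab x w) ≤ K * ENNReal.ofReal w := by
    rw [hK, add_mul]
    rcases le_total w (1 / 2) with hw' | hw'
    · refine ((surface_slab_le_of_le_half hw hw').trans ?_).trans le_add_self
      have h : 30 * w * ‖x‖ ^ 2 ≤ 30 * M ^ 2 * w := by
        have : ‖x‖ ^ 2 ≤ M ^ 2 := by gcongr
        nlinarith
      calc 3 * (ENNReal.ofReal (30 * w * ‖x‖ ^ 2) * volume (cone 1))
          ≤ 3 * (ENNReal.ofReal (30 * M ^ 2 * w) * volume (cone 1)) := by gcongr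
        _ = _ := by rw [ENNReal.ofReal_mul (by positivity)]; ring
    · refine ((measure_mono (subset_univ _)).trans ?_).trans le_self_add
      have : 1 ≤ 2 * ENNReal.ofReal w := by
        rw [← ENNReal.ofReal_ofNat, ← ENNReal.ofReal_mul (by norm_num), ENNReal.one_le_ofReal]
        linarith
      calc surface univ = 1 * surface univ := (one_mul _).symm
        _ ≤ (2 * ENNReal.ofReal w) * surface univ := by gcongr
        _ = _ := by ring
  intro w hw
  rcases hw.eq_or_lt with rfl | hw
  -- Width zero follows from positive widths by monotonicity; this case shows that the tangent
  -- planes through a given point form a null set.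
  · have hlim : Tendsto (fun w : ℝ => K * ENNReal.ofReal w) (𝓝[>] 0)
        (𝓝 (K * ENNReal.ofReal 0)) := by
      refine (ENNReal.Tendsto.const_mul (ENNReal.tendsto_ofReal tendsto_id) (Or.inr ?_)).mono_left
        nhdsWithin_le_nhds
      exact ENNReal.add_ne_top.2 ⟨ENNReal.mul_ne_top (by simp) (measure_ne_top _ _),
        ENNReal.mul_ne_top (by simp) (ENNReal.mul_ne_top ENNReal.ofReal_ne_top volume_cone_one_ne_top)⟩
    refine ge_of_tendsto hlim ?_
    filter_upwards [self_mem_nhdsWithin] with w hw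
    refine (measure_mono fun p hp => ?_).trans (hpos w hw)
    exact le_trans hp (le_of_lt (mem_Ioi.1 hw))
  · exact hpos w hw

/-! ### Uniform partitions and length. -/

/-- The `i`-th point of the partition of `[a, b]` into `n + 1` intervals of equal length. -/
noncomputable def gridPoint (a b : ℝ) (n i : ℕ) : ℝ := a + (b - a) / (n + 1) * i

theorem gridPoint_zero (a b : ℝ) (n : ℕ) : gridPoint a b n 0 = a := by simp [gridPoint]

theorem gridPoint_last (a b : ℝ) (n : ℕ) : gridPoint a b n (n + 1) = b := by
  rw [gridPoint, Nat.cast_add_one, div_mul_cancel₀ _ (by positivity)]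
  ring

theorem gridPoint_succ (a b : ℝ) (n i : ℕ) :
    gridPoint a b n (i + 1) = gridPoint a b n i + (b - a) / (n + 1) := by
  simp only [gridPoint, Nat.cast_add_one]
  ring

theorem gridPoint_mono {a b : ℝ} (hab : a ≤ b) (n : ℕ) : Monotone (gridPoint a b n) :=
  monotone_nat_of_le_succ fun i => by
    rw [gridPoint_succ]
    have := div_nonneg (sub_nonneg.2 hab) (by positivity : (0 : ℝ) ≤ n + 1)
    linarith

theorem gridPoint_mem {a b : ℝ} (hab : a ≤ b) {n i : ℕ} (hi : i ≤ n + 1) :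
    gridPoint a b n i ∈ Icc a b := by
  have h1 := gridPoint_mono hab n (Nat.zero_le i)
  have h2 := gridPoint_mono hab n hi
  rw [gridPoint_zero] at h1
  rw [gridPoint_last] at h2
  exact ⟨h1, h2⟩

theorem Icc_gridPoint_subset {a b : ℝ} (hab : a ≤ b) {n i : ℕ} (hi : i ∈ Finset.range (n + 1)) :
    Icc (gridPoint a b n i) (gridPoint a b n (i + 1)) ⊆ Icc a b := by
  rw [Finset.mem_range] at hi
  exact Icc_subset_Icc (gridPoint_mem hab (by omega)).1 (gridPoint_mem hab (by omega)).2

theorem tendsto_mesh (a b : ℝ) : Tendsto (fun n : ℕ => (b - a) / (n + 1)) atTop (𝓝 0) :=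
  tendsto_const_nhds.div_atTop
    (tendsto_atTop_add_const_right _ _ tendsto_natCast_atTop_atTop)

/-- The index of the last point of the uniform partition not exceeding `t`. -/
noncomputable def gridIndex (a b : ℝ) (n : ℕ) (t : ℝ) : ℕ := ⌊(t - a) / ((b - a) / (n + 1))⌋₊

theorem gridPoint_gridIndex_le {a b t : ℝ} (hab : a < b) (ht : a ≤ t) (n : ℕ) :
    gridPoint a b n (gridIndex a b n t) ≤ t := by
  have hm : 0 < (b - a) / (n + 1) := div_pos (sub_pos.2 hab) (by positivity)
  have h := Nat.floor_le (div_nonneg (sub_nonneg.2 ht) hm.le)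
  rw [le_div_iff₀ hm] at h
  rw [gridPoint, gridIndex]
  linarith

theorem lt_gridPoint_gridIndex_succ {a b t : ℝ} (hab : a < b) (n : ℕ) :
    t < gridPoint a b n (gridIndex a b n t + 1) := by
  have hm : 0 < (b - a) / (n + 1) := div_pos (sub_pos.2 hab) (by positivity)
  have h := Nat.lt_floor_add_one ((t - a) / ((b - a) / (n + 1)))
  rw [div_lt_iff₀ hm] at h
  rw [gridPoint, gridIndex, Nat.cast_add_one]
  linarith

theorem gridIndex_mono {a b : ℝ} (hab : a < b) (n : ℕ) : Monotone (gridIndex a b n) := by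
  intro s t hst
  have hm : 0 < (b - a) / (n + 1) := div_pos (sub_pos.2 hab) (by positivity)
  unfold gridIndex
  gcongr

theorem gridIndex_lt {a b t : ℝ} (hab : a < b) (ht : t ∈ Ico a b) (n : ℕ) :
    gridIndex a b n t < n + 1 := by
  by_contra! h
  have h1 := gridPoint_mono hab.le n h
  rw [gridPoint_last] at h1
  exact (h1.trans (gridPoint_gridIndex_le hab ht.1 n)).not_gt ht.2

theorem gridIndex_right {a b : ℝ} (hab : a < b) (n : ℕ) : gridIndex a b n b = n + 1 := by
  have : (b - a) ≠ 0 := (sub_pos.2 hab).ne'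
  have h : (b - a) / ((b - a) / (n + 1)) = ((n + 1 : ℕ) : ℝ) := by
    push_cast
    field_simp
  rw [gridIndex, h, Nat.floor_natCast]

theorem tendsto_gridPoint_gridIndex {a b t : ℝ} (hab : a < b) (ht : a ≤ t) :
    Tendsto (fun n => gridPoint a b n (gridIndex a b n t)) atTop (𝓝 t) := by
  have h : Tendsto (fun n : ℕ => t - (b - a) / (n + 1)) atTop (𝓝 (t - 0)) :=
    tendsto_const_nhds.sub (tendsto_mesh a b)
  rw [sub_zero] at h
  refine tendsto_of_tendsto_of_tendsto_of_le_of_le h tendsto_const_nhds (fun n => ?_)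
    fun n => gridPoint_gridIndex_le hab ht n
  have := lt_gridPoint_gridIndex_succ (t := t) hab n
  rw [gridPoint_succ] at this
  simp only
  linarith

/-- The length of a curve is the limit of the lengths of the polygons inscribed at uniform
partitions. -/
theorem tendsto_sum_edist {E : Type*} [PseudoEMetricSpace E] {a b : ℝ} (hab : a < b) {f : ℝ → E}
    (hf : ContinuousOn f (Icc a b)) :
    Tendsto (fun n => ∑ i ∈ Finset.range (n + 1),
      edist (f (gridPoint a b n i)) (f (gridPoint a b n (i + 1)))) atTop (𝓝 (length a b f)) := by
  have hle (n : ℕ) : ∑ i ∈ Finset.range (n + 1),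
      edist (f (gridPoint a b n i)) (f (gridPoint a b n (i + 1))) ≤ length a b f := by
    rw [← eVariationOn.image_range_of_monotone f (gridPoint_mono hab.le n)]
    apply eVariationOn.mono
    rintro _ ⟨i, hi, rfl⟩
    exact gridPoint_mem hab.le hi
  have hmaps (n : ℕ) : MapsTo (fun t => gridPoint a b n (gridIndex a b n t)) (Icc a b)
      (gridPoint a b n '' Iic (n + 1)) := by
    intro t ht
    refine ⟨_, ?_, rfl⟩
    rw [mem_Iic, ← gridIndex_right hab n]
    exact gridIndex_mono hab n ht.2
  -- Precomposing `f` with the rounding of `t` down to the grid gives step functions whose variation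
  -- is at most the polygon length. They converge pointwise to `f` by continuity, so lower
  -- semicontinuity of the variation applies.
  have hge (n : ℕ) : eVariationOn (f ∘ fun t => gridPoint a b n (gridIndex a b n t)) (Icc a b) ≤
      ∑ i ∈ Finset.range (n + 1),
        edist (f (gridPoint a b n i)) (f (gridPoint a b n (i + 1))) := by
    rw [← eVariationOn.image_range_of_monotone f (gridPoint_mono hab.le n)]
    exact eVariationOn.comp_le_of_monotoneOn f _
      (((gridPoint_mono hab.le n).comp (gridIndex_mono hab n)).monotoneOn _) (hmaps n)
  refine tendsto_order.2 ⟨fun v hv => ?_, fun v hv => .of_forall fun n => (hle n).trans_lt hv⟩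
  refine (eVariationOn.lowerSemicontinuous_aux
    (F := fun n => f ∘ fun t => gridPoint a b n (gridIndex a b n t)) (fun t ht => ?_) hv).mono
    fun n hn => hn.trans_le (hge n)
  refine (hf t ht).tendsto.comp (tendsto_nhdsWithin_iff.2
    ⟨tendsto_gridPoint_gridIndex hab ht.1, .of_forall fun n => ?_⟩)
  obtain ⟨i, hi, h⟩ := hmaps n ht
  simp only [← h]
  exact gridPoint_mem hab.le hi

theorem sum_length_gridPoint {E : Type*} [PseudoEMetricSpace E] {a b : ℝ} (hab : a ≤ b)
    (f : ℝ → E) (n : ℕ) : ∑ i ∈ Finset.range (n + 1),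
      length (gridPoint a b n i) (gridPoint a b n (i + 1)) f = length a b f := by
  have := eVariationOn.sum' f (gridPoint_mono hab n) (n := n + 1)
  rwa [gridPoint_zero, gridPoint_last] at this

/-! ### The Banach indicatrix formula. -/

section Indicatrix

variable {P : Type*} {a b : ℝ} {Z : Set ℝ}

open Classical in
/-- The indices of the intervals of the uniform partition that meet `Z`. -/
noncomputable def hits (a b : ℝ) (Z : Set ℝ) (n : ℕ) : Finset ℕ :=
  {i ∈ Finset.range (n + 1) | (Z ∩ Icc (gridPoint a b n i) (gridPoint a b n (i + 1))).Nonempty}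

theorem mem_hits {n i : ℕ} : i ∈ hits a b Z n ↔ i ∈ Finset.range (n + 1) ∧
    (Z ∩ Icc (gridPoint a b n i) (gridPoint a b n (i + 1))).Nonempty := by
  classical
  exact Finset.mem_filter

/-- Different intervals overlap at most in a grid point, and `Z` avoids those, so points chosen in
different intervals are distinct. -/
theorem card_hits_le (hab : a ≤ b) (hgrid : ∀ n i, i ≤ n + 1 → gridPoint a b n i ∉ Z) (n : ℕ) :
    ((hits a b Z n).card : ℕ∞) ≤ Z.encard := by
  have hex : ∀ i ∈ hits a b Z n,
      ∃ z, z ∈ Z ∩ Icc (gridPoint a b n i) (gridPoint a b n (i + 1)) := fun i hi =>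
    (mem_hits.1 hi).2
  choose! z hz using hex
  have hlt {i j : ℕ} (hi : i ∈ hits a b Z n) (hj : j ∈ hits a b Z n) (hij : i < j) :
      z i ≠ z j := by
    intro h
    have h1 := (hz i hi).2.2
    have h2 := (hz j hj).2.1
    have h3 := gridPoint_mono hab n (Nat.succ_le_of_lt hij)
    have h4 : z j = gridPoint a b n j := le_antisymm (h ▸ h1.trans h3) h2
    have h5 := Finset.mem_range.1 (mem_hits.1 hj).1
    exact hgrid n j (by omega) (h4 ▸ (hz j hj).1)
  have hinj : InjOn z (hits a b Z n : Set ℕ) := by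
    intro i hi j hj h
    rcases lt_trichotomy i j with hij | hij | hij
    · exact (hlt hi hj hij h).elim
    · exact hij
    · exact (hlt hj hi hij h.symm).elim
  rw [← Set.encard_coe_eq_coe_finsetCard, ← hinj.encard_image]
  apply encard_le_encard
  rintro _ ⟨i, hi, rfl⟩
  exact (hz i hi).1

/-- Once the mesh is below the gaps of a `k`-element subset of `Z`, its points have distinct
indices. The endpoint `b` is excluded because its index falls outside the range. -/
theorem eventually_le_card_hits (hab : a < b) (hZ : Z ⊆ Ico a b) {k : ℕ}
    (hk : (k : ℕ∞) ≤ Z.encard) : ∀ᶠ n in atTop, k ≤ (hits a b Z n).card := by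
  obtain ⟨F, hFZ, hFk⟩ := exists_subset_encard_eq hk
  have hfin : F.Finite := finite_of_encard_eq_coe hFk
  have hsep : ∀ᶠ n : ℕ in atTop, ∀ z ∈ F, ∀ z' ∈ F, z ≠ z' → (b - a) / (n + 1) < |z - z'| := by
    rw [hfin.eventually_all]
    intro z _
    rw [hfin.eventually_all]
    intro z' _
    by_cases h : z = z'
    · simp [h]
    · simpa [h] using (tendsto_mesh a b).eventually_lt_const (abs_sub_pos.2 h)
  filter_upwards [hsep] with n hn
  have hmem : MapsTo (gridIndex a b n) F (hits a b Z n) := by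
    intro z hz
    refine Finset.mem_coe.2 (mem_hits.2 ⟨?_, z, hFZ hz, ?_, ?_⟩)
    · exact Finset.mem_range.2 (gridIndex_lt hab (hZ (hFZ hz)) n)
    · exact gridPoint_gridIndex_le hab (hZ (hFZ hz)).1 n
    · exact (lt_gridPoint_gridIndex_succ hab n).le
  have hinj : InjOn (gridIndex a b n) F := by
    intro z hz z' hz' h
    by_contra hne
    have h1 := hn z hz z' hz' hne
    have h2 := gridPoint_gridIndex_le hab (hZ (hFZ hz)).1 n
    have h3 := gridPoint_gridIndex_le hab (hZ (hFZ hz')).1 n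
    have h4 := lt_gridPoint_gridIndex_succ (t := z) hab n
    have h5 := lt_gridPoint_gridIndex_succ (t := z') hab n
    rw [gridPoint_succ] at h4 h5
    rw [← h] at h3 h5
    exact h1.not_ge (abs_le.2 ⟨by linarith, by linarith⟩)
  have : (k : ℕ∞) ≤ (hits a b Z n).card := by
    rw [← hFk, ← hinj.encard_image, ← Set.encard_coe_eq_coe_finsetCard]
    exact encard_le_encard hmem.image_subset
  exact_mod_cast this

/-- The Banach indicatrix formula: the integral of the number of zeros is the limit of the sums
of the measures of those parameters that have a zero in an interval of a partition. -/
theorem tendsto_sum_measure_hits [MeasurableSpace P] (μ : Measure P) (hab : a < b)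
    {Z : P → Set ℝ} (hZ : ∀ p, Z p ⊆ Icc a b)
    (hmeas : ∀ s t, Icc s t ⊆ Icc a b → MeasurableSet {p | (Z p ∩ Icc s t).Nonempty})
    (hnull : ∀ t ∈ Icc a b, μ {p | t ∈ Z p} = 0) :
    Tendsto (fun n => ∑ i ∈ Finset.range (n + 1),
        μ {p | (Z p ∩ Icc (gridPoint a b n i) (gridPoint a b n (i + 1))).Nonempty}) atTop
      (𝓝 (∫⁻ p, (((Z p).encard : ℕ∞) : ℝ≥0∞) ∂μ)) := by
  classical
  let N (n : ℕ) (p : P) : ℝ≥0∞ := ∑ i ∈ Finset.range (n + 1),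
    {p | (Z p ∩ Icc (gridPoint a b n i) (gridPoint a b n (i + 1))).Nonempty}.indicator 1 p
  have hN (n : ℕ) (p : P) : N n p = ((hits a b (Z p) n).card : ℝ≥0∞) := by
    simp [N, hits, indicator_apply]
  have hm (n i : ℕ) (hi : i ∈ Finset.range (n + 1)) : MeasurableSet
      {p | (Z p ∩ Icc (gridPoint a b n i) (gridPoint a b n (i + 1))).Nonempty} :=
    hmeas _ _ (Icc_gridPoint_subset hab.le hi)
  have hNm (n : ℕ) : Measurable (N n) :=
    Finset.measurable_fun_sum _ fun i hi => measurable_one.indicator (hm n i hi)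
  have hint (n : ℕ) : ∫⁻ p, N n p ∂μ = ∑ i ∈ Finset.range (n + 1),
      μ {p | (Z p ∩ Icc (gridPoint a b n i) (gridPoint a b n (i + 1))).Nonempty} := by
    simp only [N]
    rw [lintegral_finsetSum' _
      fun i hi => (measurable_one.indicator (hm n i hi)).aemeasurable]
    exact Finset.sum_congr rfl fun i hi => lintegral_indicator_one (hm n i hi)
  have hae : ∀ᵐ p ∂μ, ∀ n i, i ≤ n + 1 → gridPoint a b n i ∉ Z p := by
    simp only [ae_all_iff]
    intro n i hi
    rw [ae_iff]
    simpa using hnull _ (gridPoint_mem hab.le hi)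
  simp only [← hint]
  -- Uniform partitions are not nested, so monotone convergence does not apply directly: Fatou's
  -- lemma gives the lower bound, and the counts never exceed the number of zeros almost everywhere.
  refine tendsto_of_le_liminf_of_limsup_le ?_ ?_
  · refine le_trans (lintegral_mono_ae ?_) (lintegral_liminf_le hNm)
    filter_upwards [hae] with p hp
    have hZ' : Z p ⊆ Ico a b := fun z hz =>
      ⟨(hZ p hz).1, (hZ p hz).2.lt_of_ne fun h =>
        hp 0 1 le_rfl (by rw [gridPoint_last a b 0, ← h]; exact hz)⟩
    refine ENNReal.le_of_forall_nnreal_lt fun r hr => ?_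
    obtain ⟨k, hrk, hk⟩ : ∃ k : ℕ, (r : ℝ≥0∞) ≤ k ∧ (k : ℕ∞) ≤ (Z p).encard := by
      rcases eq_or_ne (Z p).encard ⊤ with h | h
      · obtain ⟨k, hk⟩ := exists_nat_ge r
        exact ⟨k, by exact_mod_cast hk, by simp [h]⟩
      · obtain ⟨k, hk⟩ := ENat.ne_top_iff_exists.1 h
        refine ⟨k, ?_, hk.le⟩
        rw [← hk] at hr
        simpa using hr.le
    refine hrk.trans (le_liminf_of_le (by isBoundedDefault) ?_)
    filter_upwards [eventually_le_card_hits hab hZ' hk] with n hn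
    rw [hN]
    exact_mod_cast hn
  · refine limsup_le_of_le (by isBoundedDefault) (.of_forall fun n => lintegral_mono_ae ?_)
    filter_upwards [hae] with p hp
    rw [hN]
    have := card_hits_le hab.le hp n
    exact_mod_cast ENat.toENNReal_mono this

end Indicatrix

/-! ### The horizon as a limit over inscribed polygons. -/

/-- The set of points of the sphere whose tangent plane meets the arc of `β` over `[s, t]`. -/
def hitting (s t : ℝ) (β : ℝ → Space) : Set (Metric.sphere (0 : Space) 1) :=
  {p | ∃ u ∈ Icc s t, inner ℝ (β u) (p : Space) = 1}

theorem mem_tangentPlane {p : Metric.sphere (0 : Space) 1} {x : Space} :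
    x ∈ tangentPlane p ↔ inner ℝ x (p : Space) = 1 := by
  simp [tangentPlane, inner_sub_left, sub_eq_zero]

/-- The set is closed, as the projection of a compact set of pairs of a parameter and a point of the
sphere. -/
theorem measurableSet_hitting {s t : ℝ} {β : ℝ → Space} (hβ : ContinuousOn β (Icc s t)) :
    MeasurableSet (hitting s t β) := by
  have hc : ContinuousOn
      (fun q : ℝ × Metric.sphere (0 : Space) 1 => inner ℝ (β q.1) (q.2 : Space))
      (Icc s t ×ˢ univ) :=
    (hβ.comp continuousOn_fst fun q hq => hq.1).inner (by fun_prop)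
  have hcomp : IsCompact (Icc s t ×ˢ (univ : Set (Metric.sphere (0 : Space) 1))) :=
    isCompact_Icc.prod isCompact_univ
  have hclosed := hc.preimage_isClosed_of_isClosed hcomp.isClosed (isClosed_singleton (x := (1 : ℝ)))
  have himage : hitting s t β = Prod.snd '' ((Icc s t ×ˢ univ) ∩
      (fun q : ℝ × Metric.sphere (0 : Space) 1 => inner ℝ (β q.1) (q.2 : Space)) ⁻¹' {1}) := by
    ext p
    simp [hitting]
  rw [himage]
  exact ((hcomp.of_isClosed_subset hclosed inter_subset_left).image
    continuous_snd).isClosed.measurableSet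

theorem tendsto_sum_surface_hitting {a b : ℝ} (hab : a < b) {β : ℝ → Space}
    (hβ : ContinuousOn β (Icc a b)) :
    Tendsto (fun n => ∑ i ∈ Finset.range (n + 1),
      surface (hitting (gridPoint a b n i) (gridPoint a b n (i + 1)) β)) atTop
      (𝓝 (horizon a b β)) := by
  have hset (s t : ℝ) (hst : Icc s t ⊆ Icc a b) :
      {p | ({t ∈ Icc a b | β t ∈ tangentPlane p} ∩ Icc s t).Nonempty} = hitting s t β := by
    ext p
    simp only [hitting, mem_ofPred_eq, ← mem_tangentPlane]
    exact ⟨fun ⟨u, ⟨_, h⟩, hu⟩ => ⟨u, hu, h⟩, fun ⟨u, hu, h⟩ => ⟨u, ⟨hst hu, h⟩, hu⟩⟩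
  refine (tendsto_sum_measure_hits surface hab (Z := fun p => {t ∈ Icc a b | β t ∈ tangentPlane p})
    (fun p => sep_subset _ _) (fun s t hst => ?_) (fun t _ => ?_)).congr fun n => ?_
  · rw [hset s t hst]
    exact measurableSet_hitting (hβ.mono hst)
  · obtain ⟨K, -, hK⟩ := exists_surface_slab_le ‖β t‖
    refine measure_mono_null (fun p hp => ?_)
      (le_antisymm ((hK (β t) le_rfl 0 le_rfl).trans (by simp)) bot_le)
    simp [slab, mem_tangentPlane.1 hp.2]
  · exact Finset.sum_congr rfl fun i hi => by rw [hset _ _ (Icc_gridPoint_subset hab.le hi)]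

theorem separators_subset_hitting {s t : ℝ} (hst : s ≤ t) {β : ℝ → Space}
    (hβ : ContinuousOn β (Icc s t)) : separators (β s) (β t) ⊆ hitting s t β := by
  intro p hp
  have hc : ContinuousOn (fun u => inner ℝ (β u) (p : Space) - 1) (Icc s t) := by fun_prop
  have hs : s ∈ Icc s t := left_mem_Icc.2 hst
  have ht : t ∈ Icc s t := right_mem_Icc.2 hst
  have key : (0 : ℝ) ∈ (fun u => inner ℝ (β u) (p : Space) - 1) '' Icc s t := by
    have hp' : (inner ℝ (β s) (p : Space) - 1) * (inner ℝ (β t) (p : Space) - 1) ≤ 0 := hp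
    rcases mul_nonpos_iff.1 hp' with ⟨h1, h2⟩ | ⟨h1, h2⟩
    · exact isPreconnected_Icc.intermediate_value ht hs hc ⟨h2, h1⟩
    · exact isPreconnected_Icc.intermediate_value hs ht hc ⟨h1, h2⟩
  obtain ⟨u, hu, h⟩ := key
  exact ⟨u, hu, sub_eq_zero.1 h⟩

/-- The weighted sum is `‖x‖ + ‖y‖` times the vector from a point `z` to the chord between `z + x`
and `z + y`. -/
theorem norm_smul_add_smul_le {E : Type*} [NormedAddCommGroup E] [InnerProductSpace ℝ E]
    {x y : E} {l : ℝ} (hl : ‖x‖ + ‖y‖ ≤ l) :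
    ‖‖y‖ • x + ‖x‖ • y‖ ≤ (‖x‖ + ‖y‖) * (√(l ^ 2 - ‖x - y‖ ^ 2) / 2) := by
  have hx := norm_nonneg x
  have hy := norm_nonneg y
  have htri : ‖x - y‖ ≤ ‖x‖ + ‖y‖ := norm_sub_le x y
  have hl' : 0 ≤ l ^ 2 - ‖x - y‖ ^ 2 := by
    nlinarith [norm_nonneg (x - y)]
  refine abs_le_of_sq_le_sq' ?_ (by positivity) |>.2
  have h1 : ‖x - y‖ ^ 2 = ‖x‖ ^ 2 - 2 * inner ℝ x y + ‖y‖ ^ 2 := norm_sub_sq_real x y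
  -- After this identity, it remains to bound the product of the two norms by the square of their
  -- mean.
  have h2 : ‖‖y‖ • x + ‖x‖ • y‖ ^ 2 = ‖x‖ * ‖y‖ * ((‖x‖ + ‖y‖) ^ 2 - ‖x - y‖ ^ 2) := by
    rw [norm_add_sq_real, norm_smul, norm_smul, real_inner_smul_left, real_inner_smul_right,
      norm_norm, norm_norm, h1]
    ring
  rw [h2, mul_pow, div_pow, Real.sq_sqrt hl']
  have h3 : (‖x‖ + ‖y‖) ^ 2 - ‖x - y‖ ^ 2 ≤ l ^ 2 - ‖x - y‖ ^ 2 := by gcongr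
  have h4 : ‖x‖ * ‖y‖ ≤ (‖x‖ + ‖y‖) ^ 2 / 4 := by nlinarith [sq_nonneg (‖x‖ - ‖y‖)]
  calc ‖x‖ * ‖y‖ * ((‖x‖ + ‖y‖) ^ 2 - ‖x - y‖ ^ 2)
      ≤ (‖x‖ + ‖y‖) ^ 2 / 4 * (l ^ 2 - ‖x - y‖ ^ 2) :=
        mul_le_mul h4 h3 (by nlinarith [norm_nonneg (x - y)]) (by positivity)
    _ = _ := by ring

/-- The arc lies in the ellipsoid with foci `β s`, `β t` and major axis the length of the arc; the
slab width is its semi-minor axis. If a plane through `β u` had both foci on one side at distance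
greater than this, so would be the weighted mean of the two distances with weights `‖β t - β u‖` and
`‖β s - β u‖`, contradicting `norm_smul_add_smul_le`. -/
theorem hitting_subset {s t : ℝ} {β : ℝ → Space} (h : length s t β ≠ ∞) :
    hitting s t β ⊆ separators (β s) (β t) ∪
      (slab (β s) (√((length s t β).toReal ^ 2 - ‖β s - β t‖ ^ 2) / 2) ∪
        slab (β t) (√((length s t β).toReal ^ 2 - ‖β s - β t‖ ^ 2) / 2)) := by
  rintro p ⟨u, hu, hp⟩
  set w := √((length s t β).toReal ^ 2 - ‖β s - β t‖ ^ 2) / 2 with hw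
  have hst := hu.1.trans hu.2
  have hlen : ‖β s - β u‖ + ‖β t - β u‖ ≤ (length s t β).toReal := by
    have h1 : edist (β s) (β u) + edist (β u) (β t) ≤ length s t β := by
      have := eVariationOn.Icc_add_Icc β (s := univ) hu.1 hu.2 (mem_univ u)
      simp only [univ_inter] at this
      rw [length, ← this]
      exact add_le_add
        (eVariationOn.edist_le β (left_mem_Icc.2 hu.1) (right_mem_Icc.2 hu.1))
        (eVariationOn.edist_le β (left_mem_Icc.2 hu.2) (right_mem_Icc.2 hu.2))
    have h2 := ENNReal.toReal_mono h h1
    rwa [ENNReal.toReal_add (edist_ne_top _ _) (edist_ne_top _ _), edist_dist, edist_dist,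
      ENNReal.toReal_ofReal dist_nonneg, ENNReal.toReal_ofReal dist_nonneg, dist_eq_norm,
      dist_eq_norm, ← norm_sub_rev (β t)] at h2
  have h3 := norm_smul_add_smul_le hlen
  rw [sub_sub_sub_cancel_right, ← hw] at h3
  have h4 := (abs_real_inner_le_norm (‖β t - β u‖ • (β s - β u) + ‖β s - β u‖ • (β t - β u))
    (p : Space)).trans_eq (by rw [norm_eq_of_mem_sphere, mul_one])
  rw [inner_add_left, real_inner_smul_left, real_inner_smul_left, inner_sub_left, inner_sub_left,
    hp] at h4
  by_contra hnot
  simp only [separators, slab, mem_union, mem_ofPred_eq, not_or, not_le] at hnot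
  obtain ⟨h5, h6, h7⟩ := hnot
  have hzero : 0 < ‖β s - β u‖ + ‖β t - β u‖ := by
    by_contra! hle
    have h8 : ‖β s - β u‖ = 0 :=
      le_antisymm (by linarith [norm_nonneg (β t - β u)]) (norm_nonneg _)
    rw [norm_eq_zero, sub_eq_zero] at h8
    rw [h8, hp] at h5
    simp at h5
  have h9 := h4.trans h3
  have hd1 := norm_nonneg (β s - β u)
  have hd2 := norm_nonneg (β t - β u)
  generalize ‖β s - β u‖ = d₁ at *
  generalize ‖β t - β u‖ = d₂ at *
  generalize inner ℝ (β s) (p : Space) - 1 = v₁ at *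
  generalize inner ℝ (β t) (p : Space) - 1 = v₂ at *
  rw [abs_le] at h9
  have hmul {e₁ e₂ : ℝ} (he₁ : w < e₁) (he₂ : w < e₂) : (d₁ + d₂) * w < d₂ * e₁ + d₁ * e₂ := by
    rcases hd1.eq_or_lt with h0 | h0
    · rw [← h0] at hzero ⊢
      nlinarith
    · nlinarith
  rcases mul_pos_iff.1 h5 with ⟨h10, h11⟩ | ⟨h10, h11⟩
  · rw [abs_of_pos h10] at h6
    rw [abs_of_pos h11] at h7
    linarith [hmul h6 h7]
  · rw [abs_of_neg h10] at h6
    rw [abs_of_neg h11] at h7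
    linarith [hmul h6 h7]

section Rectifiable

variable {E : Type*} [NormedAddCommGroup E] {a b : ℝ} {β : ℝ → E}

theorem IsRectifiableCurve.length_ne_top_of_subset (hβ : IsRectifiableCurve a b β) {s t : ℝ}
    (h : Icc s t ⊆ Icc a b) : length s t β ≠ ∞ :=
  ne_top_of_le_ne_top hβ.length_ne_top (eVariationOn.mono β h)

theorem IsRectifiableCurve.norm_sub_le_length (hβ : IsRectifiableCurve a b β) {s t : ℝ}
    (hst : s ≤ t) (h : Icc s t ⊆ Icc a b) : ‖β s - β t‖ ≤ (length s t β).toReal := by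
  have h1 : edist (β s) (β t) ≤ length s t β :=
    eVariationOn.edist_le β (left_mem_Icc.2 hst) (right_mem_Icc.2 hst)
  have h2 := ENNReal.toReal_mono (hβ.length_ne_top_of_subset h) h1
  rwa [edist_dist, ENNReal.toReal_ofReal dist_nonneg, dist_eq_norm] at h2

theorem IsRectifiableCurve.sum_length (hβ : IsRectifiableCurve a b β) (n : ℕ) :
    ∑ i ∈ Finset.range (n + 1),
      (length (gridPoint a b n i) (gridPoint a b n (i + 1)) β).toReal =
      (length a b β).toReal := by
  rw [← ENNReal.toReal_sum fun i hi =>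
    hβ.length_ne_top_of_subset (Icc_gridPoint_subset hβ.lt.le hi), sum_length_gridPoint hβ.lt.le]

theorem IsRectifiableCurve.norm_gridPoint_sub_le (hβ : IsRectifiableCurve a b β) {n i : ℕ}
    (hi : i ∈ Finset.range (n + 1)) : ‖β (gridPoint a b n i) - β (gridPoint a b n (i + 1))‖ ≤
      (length (gridPoint a b n i) (gridPoint a b n (i + 1)) β).toReal :=
  hβ.norm_sub_le_length (gridPoint_mono hβ.lt.le n i.le_succ) (Icc_gridPoint_subset hβ.lt.le hi)

theorem IsRectifiableCurve.sum_norm_le (hβ : IsRectifiableCurve a b β) (n : ℕ) :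
    ∑ i ∈ Finset.range (n + 1), ‖β (gridPoint a b n i) - β (gridPoint a b n (i + 1))‖ ≤
      (length a b β).toReal := by
  rw [← hβ.sum_length n]
  exact Finset.sum_le_sum fun i hi => hβ.norm_gridPoint_sub_le hi

theorem IsRectifiableCurve.tendsto_sum_length_sub (hβ : IsRectifiableCurve a b β) :
    Tendsto (fun n => ∑ i ∈ Finset.range (n + 1),
      ((length (gridPoint a b n i) (gridPoint a b n (i + 1)) β).toReal -
        ‖β (gridPoint a b n i) - β (gridPoint a b n (i + 1))‖)) atTop (𝓝 0) := by
  simp only [Finset.sum_sub_distrib, hβ.sum_length]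
  rw [← sub_self (length a b β).toReal]
  refine tendsto_const_nhds.sub ?_
  refine ((ENNReal.tendsto_toReal hβ.length_ne_top).comp
    (tendsto_sum_edist hβ.lt hβ.continuousOn)).congr fun n => ?_
  rw [Function.comp, ENNReal.toReal_sum fun i _ => edist_ne_top _ _]
  simp only [edist_dist, dist_eq_norm, ENNReal.toReal_ofReal (norm_nonneg _)]

/-- Factor `l ^ 2 - c ^ 2 = (l - c) * (l + c)` and apply Cauchy–Schwarz: the sum of `l - c` tends to
zero, while the sum of `l + c` is at most twice the length. -/
theorem IsRectifiableCurve.tendsto_sum_sqrt (hβ : IsRectifiableCurve a b β) :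
    Tendsto (fun n => ∑ i ∈ Finset.range (n + 1),
      √((length (gridPoint a b n i) (gridPoint a b n (i + 1)) β).toReal ^ 2 -
        ‖β (gridPoint a b n i) - β (gridPoint a b n (i + 1))‖ ^ 2) / 2) atTop (𝓝 0) := by
  set l := fun n i : ℕ => (length (gridPoint a b n i) (gridPoint a b n (i + 1)) β).toReal
  set c := fun n i : ℕ => ‖β (gridPoint a b n i) - β (gridPoint a b n (i + 1))‖
  have hlim : Tendsto (fun n => √(∑ i ∈ Finset.range (n + 1), (l n i - c n i)) *
      √(2 * (length a b β).toReal) / 2) atTop (𝓝 (√0 * √(2 * (length a b β).toReal) / 2)) :=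
    (((Real.continuous_sqrt.tendsto 0).comp hβ.tendsto_sum_length_sub).mul_const _).div_const _
  rw [Real.sqrt_zero, zero_mul, zero_div] at hlim
  refine squeeze_zero (fun n => Finset.sum_nonneg fun i _ => by positivity) (fun n => ?_) hlim
  have hc (i : ℕ) (hi : i ∈ Finset.range (n + 1)) : c n i ≤ l n i := hβ.norm_gridPoint_sub_le hi
  have hc0 (i : ℕ) : 0 ≤ c n i := norm_nonneg _
  rw [← Finset.sum_div]
  gcongr
  calc ∑ i ∈ Finset.range (n + 1), √(l n i ^ 2 - c n i ^ 2)
      = ∑ i ∈ Finset.range (n + 1), √(l n i - c n i) * √(l n i + c n i) :=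
        Finset.sum_congr rfl fun i hi => by
          rw [← Real.sqrt_mul (sub_nonneg.2 (hc i hi))]
          congr 1
          ring
    _ ≤ √(∑ i ∈ Finset.range (n + 1), √(l n i - c n i) ^ 2) *
        √(∑ i ∈ Finset.range (n + 1), √(l n i + c n i) ^ 2) :=
        Real.sum_mul_le_sqrt_mul_sqrt _ _ _
    _ = √(∑ i ∈ Finset.range (n + 1), (l n i - c n i)) *
        √(∑ i ∈ Finset.range (n + 1), (l n i + c n i)) := by
        congr 2
        · exact Finset.sum_congr rfl fun i hi => Real.sq_sqrt (sub_nonneg.2 (hc i hi))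
        · exact Finset.sum_congr rfl fun i hi =>
            Real.sq_sqrt (by linarith [hc i hi, hc0 i])
    _ ≤ _ := by
        gcongr
        rw [Finset.sum_add_distrib, two_mul]
        exact add_le_add (hβ.sum_length n).le (hβ.sum_norm_le n)

end Rectifiable

/-- The horizon is the limit of the horizons of inscribed polygons. -/
theorem IsRectifiableCurve.tendsto_sum_surface_separators {a b : ℝ} {β : ℝ → Space}
    (hβ : IsRectifiableCurve a b β) :
    Tendsto (fun n => ∑ i ∈ Finset.range (n + 1),
      surface (separators (β (gridPoint a b n i)) (β (gridPoint a b n (i + 1))))) atTop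
      (𝓝 (horizon a b β)) := by
  obtain ⟨M, hM⟩ := isCompact_Icc.exists_bound_of_continuousOn hβ.continuousOn
  obtain ⟨K, hKtop, hK⟩ := exists_surface_slab_le M
  have hab := hβ.lt.le
  set w := fun n i : ℕ => √((length (gridPoint a b n i) (gridPoint a b n (i + 1)) β).toReal ^ 2 -
        ‖β (gridPoint a b n i) - β (gridPoint a b n (i + 1))‖ ^ 2) / 2
  have hw (n i : ℕ) : 0 ≤ w n i := by positivity
  have hε : Tendsto (fun n => 2 * K * ENNReal.ofReal (∑ i ∈ Finset.range (n + 1), w n i)) atTop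
      (𝓝 (2 * K * ENNReal.ofReal 0)) :=
    ENNReal.Tendsto.const_mul (ENNReal.tendsto_ofReal hβ.tendsto_sum_sqrt)
      (Or.inr (ENNReal.mul_ne_top (by simp) hKtop))
  rw [ENNReal.ofReal_zero, mul_zero] at hε
  have hhit := tendsto_sum_surface_hitting hβ.lt hβ.continuousOn
  have hsub := ENNReal.Tendsto.sub hhit hε (Or.inr ENNReal.zero_ne_top)
  rw [tsub_zero] at hsub
  -- Each separator area lies between the hitting area minus two slab areas and the hitting area.
  refine tendsto_of_tendsto_of_tendsto_of_le_of_le hsub hhit (fun n => ?_) fun n => ?_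
  · refine tsub_le_iff_right.2 ?_
    rw [ENNReal.ofReal_sum_of_nonneg fun i _ => hw n i, Finset.mul_sum, ← Finset.sum_add_distrib]
    refine Finset.sum_le_sum fun i hi => ?_
    have hsubset := Icc_gridPoint_subset hab hi
    have hle := gridPoint_mono hab n i.le_succ
    have h1 := hM _ (hsubset (left_mem_Icc.2 hle))
    have h2 := hM _ (hsubset (right_mem_Icc.2 hle))
    refine (measure_mono (hitting_subset (hβ.length_ne_top_of_subset hsubset))).trans
      ((measure_union_le _ _).trans ?_)
    gcongr
    refine (measure_union_le _ _).trans
      ((add_le_add (hK _ h1 _ (hw n i)) (hK _ h2 _ (hw n i))).trans_eq ?_)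
    ring
  · refine Finset.sum_le_sum fun i hi => measure_mono ?_
    exact separators_subset_hitting (gridPoint_mono hab n i.le_succ)
      (hβ.continuousOn.mono (Icc_gridPoint_subset hab hi))

/-- Two one-sided bounds instead of a bound on a difference allow infinite limits, so finiteness of
the horizon is not needed. -/
theorem eq_of_tendsto_of_le_add {u v ε : ℕ → ℝ≥0∞} {x y : ℝ≥0∞} (hu : Tendsto u atTop (𝓝 x))
    (hv : Tendsto v atTop (𝓝 y)) (hε : Tendsto ε atTop (𝓝 0)) (huv : ∀ n, u n ≤ v n + ε n)
    (hvu : ∀ n, v n ≤ u n + ε n) : x = y := by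
  refine le_antisymm ?_ ?_
  · simpa using le_of_tendsto_of_tendsto' hu (hv.add hε) huv
  · simpa using le_of_tendsto_of_tendsto' hv (hu.add hε) hvu

/-! ### Polar coordinates, angles and chords. -/

/-- The point of the horizontal plane with polar coordinates `r` and `φ`. -/
noncomputable def polarPoint (r φ : ℝ) : Space := !₂[r * Real.cos φ, r * Real.sin φ, 0]

theorem planeInclusion_unfolding (a : ℝ) (γ : ℝ → Space) (t : ℝ) :
    planeInclusion (unfolding a γ t) = polarPoint ‖γ t‖ (coneAngle a γ t) := rfl

theorem inner_polarPoint (r r' φ φ' : ℝ) :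
    inner ℝ (polarPoint r φ) (polarPoint r' φ') = r * r' * Real.cos (φ' - φ) := by
  simp only [polarPoint, PiLp.inner_apply, Fin.sum_univ_three, Real.cos_sub]
  simp
  ring

theorem norm_polarPoint {r : ℝ} (hr : 0 ≤ r) (φ : ℝ) : ‖polarPoint r φ‖ = r := by
  rw [norm_eq_sqrt_real_inner, inner_polarPoint, sub_self, Real.cos_zero, mul_one,
    Real.sqrt_mul_self hr]

theorem norm_polarPoint_sub_le {r : ℝ} (hr : 0 ≤ r) (φ ψ : ℝ) :
    ‖polarPoint r φ - polarPoint r ψ‖ ≤ r * |φ - ψ| := by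
  refine (abs_le_of_sq_le_sq' ?_ (by positivity)).2
  rw [norm_sub_sq_real, norm_polarPoint hr, norm_polarPoint hr, inner_polarPoint, mul_pow, sq_abs]
  nlinarith [Real.one_sub_sq_div_two_le_cos (x := ψ - φ), mul_nonneg hr hr]

theorem isometry_planeInclusion : Isometry planeInclusion := by
  refine Isometry.of_dist_eq fun x y => ?_
  simp [EuclideanSpace.dist_eq, planeInclusion, Fin.sum_univ_three]

theorem length_planeInclusion (s t : ℝ) (β : ℝ → Plane) :
    length s t (fun u => planeInclusion (β u)) = length s t β := by
  simp only [length, eVariationOn, isometry_planeInclusion.edist_eq]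

section Angle

variable {E : Type*} [NormedAddCommGroup E] [InnerProductSpace ℝ E] {x y : E}

theorem norm_normalize_sub_normalize (hx : x ≠ 0) (hy : y ≠ 0) :
    ‖‖x‖⁻¹ • x - ‖y‖⁻¹ • y‖ = 2 * Real.sin (InnerProductGeometry.angle x y / 2) := by
  have hx' := norm_ne_zero_iff.2 hx
  have hy' := norm_ne_zero_iff.2 hy
  have h0 := InnerProductGeometry.angle_nonneg x y
  have hpi := InnerProductGeometry.angle_le_pi x y
  have hsin : 0 ≤ Real.sin (InnerProductGeometry.angle x y / 2) :=
    Real.sin_nonneg_of_nonneg_of_le_pi (by linarith) (by linarith)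
  rw [← sq_eq_sq₀ (norm_nonneg _) (by positivity), norm_sub_sq_real, norm_smul, norm_smul,
    norm_inv, norm_inv, norm_norm, norm_norm, inv_mul_cancel₀ hx', inv_mul_cancel₀ hy',
    real_inner_smul_left, real_inner_smul_right,
    ← InnerProductGeometry.cos_angle_mul_norm_mul_norm, mul_pow, Real.sin_sq_eq_half_sub,
    mul_div_cancel₀ _ two_ne_zero]
  field_simp
  ring

/-- The chord is `2 * sin (α / 2)`. It falls short of `α` by at most `α ^ 3 / 24`, and Jordan's
inequality gives `α / 4 ≤ sin (α / 2)`, so its cube is at least `α ^ 3 / 8`. -/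
theorem abs_angle_sub_norm_normalize_sub_le (hx : x ≠ 0) (hy : y ≠ 0) :
    |InnerProductGeometry.angle x y - ‖‖x‖⁻¹ • x - ‖y‖⁻¹ • y‖| ≤
      ‖‖x‖⁻¹ • x - ‖y‖⁻¹ • y‖ ^ 3 := by
  rw [norm_normalize_sub_normalize hx hy]
  have h0 := InnerProductGeometry.angle_nonneg x y
  have hpi := InnerProductGeometry.angle_le_pi x y
  generalize InnerProductGeometry.angle x y = α at *
  rcases h0.eq_or_lt with rfl | h0
  · simp
  have h1 : Real.sin (α / 2) < α / 2 := Real.sin_lt (by linarith)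
  have h2 : α / 2 - (α / 2) ^ 3 / 6 < Real.sin (α / 2) := Real.sin_gt_sub_cube (by linarith)
  have h3 : 2 / Real.pi * (α / 2) ≤ Real.sin (α / 2) :=
    Real.mul_le_sin (by linarith) (by linarith)
  have h4 : α / 4 ≤ Real.sin (α / 2) := by
    refine le_trans ?_ h3
    have := Real.pi_le_four
    rw [div_mul_eq_mul_div, le_div_iff₀ Real.pi_pos]
    nlinarith
  have h5 : (α / 4) ^ 3 ≤ Real.sin (α / 2) ^ 3 := by gcongr
  rw [abs_of_nonneg (by linarith)]
  nlinarith

theorem norm_normalize_sub_normalize_le {m : ℝ} (hm : 0 < m) (hx : m ≤ ‖x‖) (hy : m ≤ ‖y‖) :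
    ‖‖x‖⁻¹ • x - ‖y‖⁻¹ • y‖ ≤ 2 / m * ‖x - y‖ := by
  have hx' : 0 < ‖x‖ := hm.trans_le hx
  have hy' : 0 < ‖y‖ := hm.trans_le hy
  have h : ‖x‖⁻¹ • x - ‖y‖⁻¹ • y = ‖x‖⁻¹ • ((x - y) + (‖y‖ - ‖x‖) • ‖y‖⁻¹ • y) := by
    rw [smul_add, smul_sub, sub_smul, smul_sub, smul_smul ‖y‖, mul_inv_cancel₀ hy'.ne', one_smul,
      smul_smul ‖x‖⁻¹ ‖x‖, inv_mul_cancel₀ hx'.ne', one_smul]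
    abel
  have h1 : ‖(x - y) + (‖y‖ - ‖x‖) • ‖y‖⁻¹ • y‖ ≤ 2 * ‖x - y‖ := by
    refine (norm_add_le _ _).trans ?_
    rw [norm_smul, norm_smul, norm_inv, norm_norm, inv_mul_cancel₀ hy'.ne', mul_one,
      Real.norm_eq_abs, two_mul, norm_sub_rev x y]
    gcongr
    exact abs_norm_sub_norm_le y x
  rw [h, norm_smul, norm_inv, norm_norm, div_mul_eq_mul_div, inv_mul_eq_div]
  gcongr

end Angle

/-- Comparison of a chord with the chord between points of the plane that have the same distances
to the origin and the polar angles `φ` and `ψ`. -/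
theorem exists_inner_eq_norm_sub_le (x y : Space) (φ ψ : ℝ) :
    ∃ z : Space, ‖z‖ = ‖y‖ ∧ inner ℝ (polarPoint ‖x‖ φ) z = inner ℝ x y ∧
      ‖z - polarPoint ‖y‖ ψ‖ ≤ ‖y‖ * |InnerProductGeometry.angle x y - (ψ - φ)| := by
  -- This point makes the planar pair congruent to `x`, `y`.
  refine ⟨polarPoint ‖y‖ (φ + InnerProductGeometry.angle x y), norm_polarPoint (norm_nonneg y) _,
    ?_, ?_⟩
  · rw [inner_polarPoint, add_sub_cancel_left, ← InnerProductGeometry.cos_angle_mul_norm_mul_norm]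
    ring
  · refine (norm_polarPoint_sub_le (norm_nonneg y) _ _).trans_eq ?_
    congr 2
    ring

theorem abs_norm_sub_sub_le (x y : Space) (φ ψ : ℝ) :
    |‖x - y‖ - ‖polarPoint ‖x‖ φ - polarPoint ‖y‖ ψ‖| ≤
      ‖y‖ * |InnerProductGeometry.angle x y - (ψ - φ)| := by
  obtain ⟨z, hz, hxz, hzy⟩ := exists_inner_eq_norm_sub_le x y φ ψ
  have h : ‖x - y‖ = ‖polarPoint ‖x‖ φ - z‖ := by
    rw [← sq_eq_sq₀ (norm_nonneg _) (norm_nonneg _), norm_sub_sq_real, norm_sub_sq_real, hxz, hz,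
      norm_polarPoint (norm_nonneg x)]
  rw [h]
  refine (abs_norm_sub_norm_le _ _).trans (le_trans (le_of_eq ?_) hzy)
  rw [sub_sub_sub_cancel_left, norm_sub_rev]

/-- Passing to the congruent planar pair leaves the area unchanged; then turning the second point to
the polar angle `ψ` costs one slab. -/
theorem surface_separators_le {M : ℝ} {K : ℝ≥0∞}
    (hK : ∀ x : Space, ‖x‖ ≤ M → ∀ w : ℝ, 0 ≤ w → surface (slab x w) ≤ K * ENNReal.ofReal w)
    {x y : Space} (hy : ‖y‖ ≤ M) (φ ψ : ℝ) :
    surface (separators x y) ≤ surface (separators (polarPoint ‖x‖ φ) (polarPoint ‖y‖ ψ)) +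
        K * ENNReal.ofReal (‖y‖ * |InnerProductGeometry.angle x y - (ψ - φ)|) ∧
      surface (separators (polarPoint ‖x‖ φ) (polarPoint ‖y‖ ψ)) ≤ surface (separators x y) +
        K * ENNReal.ofReal (‖y‖ * |InnerProductGeometry.angle x y - (ψ - φ)|) := by
  obtain ⟨z, hz, hxz, hzy⟩ := exists_inner_eq_norm_sub_le x y φ ψ
  rw [surface_separators_congr (norm_polarPoint (norm_nonneg x) φ).symm hz.symm hxz.symm]
  constructor
  · refine (measure_mono (separators_subset _ z (polarPoint ‖y‖ ψ))).trans
      ((measure_union_le _ _).trans ?_)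
    gcongr
    refine (hK _ (by rwa [norm_polarPoint (norm_nonneg y)]) _ (norm_nonneg _)).trans ?_
    gcongr
  · refine (measure_mono (separators_subset _ (polarPoint ‖y‖ ψ) z)).trans
      ((measure_union_le _ _).trans ?_)
    gcongr
    refine (hK _ (by rwa [hz]) _ (norm_nonneg _)).trans ?_
    rw [norm_sub_rev]
    gcongr

theorem IsRectifiableCurve.mono {E : Type*} [PseudoEMetricSpace E] {a b s t : ℝ} {β : ℝ → E}
    (hβ : IsRectifiableCurve a b β) (hst : s < t) (h : Icc s t ⊆ Icc a b) :
    IsRectifiableCurve s t β :=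
  ⟨hst, hβ.continuousOn.mono h, ne_top_of_le_ne_top hβ.length_ne_top (eVariationOn.mono β h)⟩

/-! ### Cone angle and unfolding. -/

section Unfolding

variable {a b : ℝ} {γ : ℝ → Space}

/-- By compactness the curve stays at a positive distance from the origin, where radial projection
is Lipschitz. -/
theorem IsRectifiableCurve.radialProjection (hγ : IsRectifiableCurve a b γ)
    (h0 : ∀ t ∈ Icc a b, γ t ≠ 0) : IsRectifiableCurve a b (radialProjection γ) := by
  refine ⟨hγ.lt, ?_, ?_⟩
  · exact (hγ.continuousOn.norm.inv₀ fun t ht => norm_ne_zero_iff.2 (h0 t ht)).smul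
      hγ.continuousOn
  · obtain ⟨t₀, ht₀, hmin⟩ := isCompact_Icc.exists_isMinOn (nonempty_Icc.2 hγ.lt.le)
      hγ.continuousOn.norm
    have hm : 0 < ‖γ t₀‖ := norm_pos_iff.2 (h0 t₀ ht₀)
    have hlip : LipschitzOnWith (Real.toNNReal (2 / ‖γ t₀‖)) (fun x : Space => ‖x‖⁻¹ • x)
        (γ '' Icc a b) := by
      refine LipschitzOnWith.of_dist_le_mul ?_
      rintro _ ⟨s, hs, rfl⟩ _ ⟨t, ht, rfl⟩
      rw [Real.coe_toNNReal _ (by positivity), dist_eq_norm, dist_eq_norm]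
      exact norm_normalize_sub_normalize_le hm (hmin hs) (hmin ht)
    exact hlip.comp_boundedVariationOn (mapsTo_image γ _) hγ.length_ne_top

theorem coneAngle_sub (hγ : IsRectifiableCurve a b γ) (h0 : ∀ t ∈ Icc a b, γ t ≠ 0) {s t : ℝ}
    (hs : a ≤ s) (hst : s ≤ t) (ht : t ≤ b) :
    coneAngle a γ t - coneAngle a γ s = (length s t (radialProjection γ)).toReal := by
  have hρ := hγ.radialProjection h0
  have h := eVariationOn.Icc_add_Icc (radialProjection γ) (s := univ) hs hst (mem_univ s)
  simp only [univ_inter] at h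
  rw [coneAngle, coneAngle, sub_eq_iff_eq_add', ← ENNReal.toReal_add]
  · exact congrArg _ h.symm
  · exact hρ.length_ne_top_of_subset (Icc_subset_Icc le_rfl (hst.trans ht))
  · exact hρ.length_ne_top_of_subset (Icc_subset_Icc hs ht)

/-- A continuous curve of bounded variation has vanishing variation on intervals shrinking to a
point from either side. -/
theorem continuousOn_coneAngle (hγ : IsRectifiableCurve a b γ) (h0 : ∀ t ∈ Icc a b, γ t ≠ 0) :
    ContinuousOn (coneAngle a γ) (Icc a b) := by
  intro t₀ ht₀
  have hρ := hγ.radialProjection h0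
  have hbv : BoundedVariationOn (radialProjection γ) (Icc a b) := hρ.length_ne_top
  have hl := hbv.tendsto_eVariationOn_Icc_zero_left
    ((hρ.continuousOn t₀ ht₀).mono inter_subset_left)
  have hr := hbv.tendsto_eVariationOn_Icc_zero_right t₀
    ((hρ.continuousOn t₀ ht₀).mono inter_subset_left)
  have hlim := ((ENNReal.tendsto_toReal ENNReal.zero_ne_top).comp hl).add
    ((ENNReal.tendsto_toReal ENNReal.zero_ne_top).comp hr)
  rw [ENNReal.toReal_zero, add_zero] at hlim
  refine tendsto_iff_dist_tendsto_zero.2 (squeeze_zero' (.of_forall fun _ => dist_nonneg) ?_ hlim)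
  filter_upwards [self_mem_nhdsWithin] with t ht
  simp only [Function.comp_apply]
  have hinter {s t : ℝ} (hs : s ∈ Icc a b) (ht : t ∈ Icc a b) : Icc a b ∩ Icc s t = Icc s t :=
    inter_eq_right.2 (Icc_subset_Icc hs.1 ht.2)
  rw [hinter ht ht₀, hinter ht₀ ht, Real.dist_eq]
  rcases le_total t t₀ with h | h
  · rw [abs_sub_comm, coneAngle_sub hγ h0 ht.1 h ht₀.2, abs_of_nonneg ENNReal.toReal_nonneg]
    exact le_add_of_nonneg_right ENNReal.toReal_nonneg
  · rw [coneAngle_sub hγ h0 ht₀.1 h ht.2, abs_of_nonneg ENNReal.toReal_nonneg]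
    exact le_add_of_nonneg_left ENNReal.toReal_nonneg

/-- By uniform continuity all chords are eventually at most `η`, so the sum of their cubes is at
most `η ^ 2` times the length. -/
theorem IsRectifiableCurve.tendsto_sum_norm_pow_three {E : Type*} [NormedAddCommGroup E]
    {β : ℝ → E} (hβ : IsRectifiableCurve a b β) :
    Tendsto (fun n => ∑ i ∈ Finset.range (n + 1),
      ‖β (gridPoint a b n i) - β (gridPoint a b n (i + 1))‖ ^ 3) atTop (𝓝 0) := by
  have hL : 0 ≤ (length a b β).toReal := ENNReal.toReal_nonneg
  rw [Metric.tendsto_atTop']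
  intro ε hε
  obtain ⟨η, hη, hηε⟩ : ∃ η > 0, η ^ 2 * (length a b β).toReal < ε := by
    have : Tendsto (fun η : ℝ => η ^ 2 * (length a b β).toReal) (𝓝[>] 0) (𝓝 0) := by
      refine (Continuous.tendsto' (by fun_prop) 0 0 (by simp)).mono_left nhdsWithin_le_nhds
    obtain ⟨η, h, hη⟩ := ((this.eventually_lt_const hε).and self_mem_nhdsWithin).exists
    exact ⟨η, hη, h⟩
  obtain ⟨δ, hδ, hunif⟩ := Metric.uniformContinuousOn_iff_le.1
    (isCompact_Icc.uniformContinuousOn_of_continuous hβ.continuousOn) η hη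
  obtain ⟨N, hN⟩ := eventually_atTop.1 ((tendsto_mesh a b).eventually_lt_const hδ)
  refine ⟨N, fun n hn => ?_⟩
  rw [dist_zero_right, Real.norm_of_nonneg (Finset.sum_nonneg fun i _ => by positivity)]
  refine lt_of_le_of_lt ?_ hηε
  refine le_trans ?_ (mul_le_mul_of_nonneg_left (hβ.sum_norm_le n) (by positivity))
  rw [Finset.mul_sum]
  refine Finset.sum_le_sum fun i hi => ?_
  have hi' := Finset.mem_range.1 hi
  have h := hunif _ (gridPoint_mem hβ.lt.le (show i ≤ n + 1 by omega)) _
    (gridPoint_mem hβ.lt.le (show i + 1 ≤ n + 1 by omega)) (by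
      rw [gridPoint_succ, dist_self_add_right, Real.norm_of_nonneg
        (div_nonneg (sub_nonneg.2 hβ.lt.le) (by positivity))]
      exact (hN n hn.le).le)
  rw [dist_eq_norm] at h
  rw [pow_succ]
  gcongr

/-- The differences between the angles of the inscribed polygons and the increments of the cone
angle sum up to zero in the limit. -/
theorem tendsto_sum_abs_angle_sub (hγ : IsRectifiableCurve a b γ) (h0 : ∀ t ∈ Icc a b, γ t ≠ 0)
    {s t : ℝ} (hst : s < t) (h : Icc s t ⊆ Icc a b) :
    Tendsto (fun n => ∑ i ∈ Finset.range (n + 1),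
      |InnerProductGeometry.angle (γ (gridPoint s t n i)) (γ (gridPoint s t n (i + 1))) -
        (coneAngle a γ (gridPoint s t n (i + 1)) - coneAngle a γ (gridPoint s t n i))|)
      atTop (𝓝 0) := by
  have hρ := (hγ.radialProjection h0).mono hst h
  -- The chord of the radial projection mediates: the cubes bound its distance to the angle, and the
  -- second sum its distance to the arc length.
  have hlim := hρ.tendsto_sum_norm_pow_three.add hρ.tendsto_sum_length_sub
  rw [add_zero] at hlim
  refine squeeze_zero (fun n => Finset.sum_nonneg fun i _ => abs_nonneg _) (fun n => ?_) hlim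
  rw [← Finset.sum_add_distrib]
  refine Finset.sum_le_sum fun i hi => ?_
  have hle := gridPoint_mono hst.le n i.le_succ
  have hsub := (Icc_gridPoint_subset hst.le hi).trans h
  have h1 := hsub (left_mem_Icc.2 hle)
  have h2 := hsub (right_mem_Icc.2 hle)
  have h3 := abs_angle_sub_norm_normalize_sub_le (h0 _ h1) (h0 _ h2)
  have h4 := hρ.norm_gridPoint_sub_le hi
  rw [coneAngle_sub hγ h0 h1.1 hle h2.2]
  simp only [radialProjection] at h4 ⊢
  rw [abs_le] at h3 ⊢
  constructor <;> linarith [h3.1, h3.2]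

theorem tendsto_sum_norm_mul_abs_angle_sub (hγ : IsRectifiableCurve a b γ)
    (h0 : ∀ t ∈ Icc a b, γ t ≠ 0) {s t : ℝ} (hst : s < t) (h : Icc s t ⊆ Icc a b) :
    Tendsto (fun n => ∑ i ∈ Finset.range (n + 1), ‖γ (gridPoint s t n (i + 1))‖ *
      |InnerProductGeometry.angle (γ (gridPoint s t n i)) (γ (gridPoint s t n (i + 1))) -
        (coneAngle a γ (gridPoint s t n (i + 1)) - coneAngle a γ (gridPoint s t n i))|)
      atTop (𝓝 0) := by
  obtain ⟨M, hM⟩ := isCompact_Icc.exists_bound_of_continuousOn hγ.continuousOn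
  have hlim := (tendsto_sum_abs_angle_sub hγ h0 hst h).const_mul M
  rw [mul_zero] at hlim
  refine squeeze_zero (fun n => Finset.sum_nonneg fun i _ => by positivity) (fun n => ?_) hlim
  rw [Finset.mul_sum]
  refine Finset.sum_le_sum fun i hi => ?_
  have hle := gridPoint_mono hst.le n i.le_succ
  have := hM _ (h (Icc_gridPoint_subset hst.le hi (right_mem_Icc.2 hle)))
  gcongr

theorem norm_unfolding (a : ℝ) (γ : ℝ → Space) (t : ℝ) : ‖unfolding a γ t‖ = ‖γ t‖ := by
  rw [EuclideanSpace.norm_eq, ← Real.sqrt_sq (norm_nonneg (γ t))]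
  congr 1
  simp only [unfolding, Fin.sum_univ_two, Real.norm_eq_abs, sq_abs]
  simp only [Matrix.cons_val_zero, Matrix.cons_val_one]
  linear_combination ‖γ t‖ ^ 2 * Real.sin_sq_add_cos_sq (coneAngle a γ t)

theorem continuousOn_unfolding (hγ : IsRectifiableCurve a b γ) (h0 : ∀ t ∈ Icc a b, γ t ≠ 0) :
    ContinuousOn (unfolding a γ) (Icc a b) := by
  have hθ := continuousOn_coneAngle hγ h0
  have hn := hγ.continuousOn.norm
  refine (PiLp.continuous_toLp 2 _).comp_continuousOn (continuousOn_pi.2 fun i => ?_)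
  fin_cases i
  · exact hn.mul (Real.continuous_cos.comp_continuousOn hθ)
  · exact hn.mul (Real.continuous_sin.comp_continuousOn hθ)

theorem length_unfolding (hγ : IsRectifiableCurve a b γ) (h0 : ∀ t ∈ Icc a b, γ t ≠ 0) {s t : ℝ}
    (hs : s ∈ Icc a b) (ht : t ∈ Icc a b) (hst : s ≤ t) :
    length s t (unfolding a γ) = length s t γ := by
  rcases hst.eq_or_lt with rfl | hst
  · simp [length, eVariationOn.subsingleton]
  have h : Icc s t ⊆ Icc a b := Icc_subset_Icc hs.1 ht.2
  have hε := ENNReal.tendsto_ofReal (tendsto_sum_norm_mul_abs_angle_sub hγ h0 hst h)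
  rw [ENNReal.ofReal_zero] at hε
  have hdist (u v : ℝ) : |dist (γ u) (γ v) - dist (unfolding a γ u) (unfolding a γ v)| ≤
      ‖γ v‖ * |InnerProductGeometry.angle (γ u) (γ v) - (coneAngle a γ v - coneAngle a γ u)| := by
    rw [← isometry_planeInclusion.dist_eq, dist_eq_norm, dist_eq_norm]
    exact abs_norm_sub_sub_le _ _ _ _
  refine eq_of_tendsto_of_le_add
    (tendsto_sum_edist hst ((continuousOn_unfolding hγ h0).mono h))
    (tendsto_sum_edist hst (hγ.continuousOn.mono h)) hε (fun n => ?_) (fun n => ?_)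
  all_goals
    rw [ENNReal.ofReal_sum_of_nonneg fun i _ => by positivity, ← Finset.sum_add_distrib]
    refine Finset.sum_le_sum fun i _ => ?_
    rw [edist_dist, edist_dist, ← ENNReal.ofReal_add dist_nonneg (by positivity)]
    have := abs_le.1 (hdist (gridPoint s t n i) (gridPoint s t n (i + 1)))
    exact ENNReal.ofReal_le_ofReal (by linarith [this.1, this.2])

theorem IsRectifiableCurve.unfolding (hγ : IsRectifiableCurve a b γ)
    (h0 : ∀ t ∈ Icc a b, γ t ≠ 0) : IsRectifiableCurve a b (unfolding a γ) := by
  refine ⟨hγ.lt, continuousOn_unfolding hγ h0, ?_⟩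
  rw [length_unfolding hγ h0 (left_mem_Icc.2 hγ.lt.le) (right_mem_Icc.2 hγ.lt.le) hγ.lt.le]
  exact hγ.length_ne_top

/-- As for length, the polygonal sums of both curves differ edge by edge by a multiple of the angle
defect; `K` is uniform because the curve is bounded. -/
theorem horizon_unfolding (hγ : IsRectifiableCurve a b γ) (h0 : ∀ t ∈ Icc a b, γ t ≠ 0) :
    horizon a b γ = horizon a b (fun t => planeInclusion (unfolding a γ t)) := by
  have hu := hγ.unfolding h0
  have hu' : IsRectifiableCurve a b fun t => planeInclusion (ConeUnfolding.unfolding a γ t) :=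
    ⟨hu.lt, isometry_planeInclusion.continuous.comp_continuousOn hu.continuousOn,
      by rw [length_planeInclusion]; exact hu.length_ne_top⟩
  obtain ⟨M, hM⟩ := isCompact_Icc.exists_bound_of_continuousOn hγ.continuousOn
  obtain ⟨K, hKtop, hK⟩ := exists_surface_slab_le M
  have hε := ENNReal.Tendsto.const_mul (a := K) (ENNReal.tendsto_ofReal
    (tendsto_sum_norm_mul_abs_angle_sub hγ h0 hγ.lt Subset.rfl)) (Or.inr hKtop)
  rw [ENNReal.ofReal_zero, mul_zero] at hε
  have hle (n i : ℕ) (hi : i ∈ Finset.range (n + 1)) := surface_separators_le hK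
    (x := γ (gridPoint a b n i)) (hM _ (Icc_gridPoint_subset hγ.lt.le hi
      (right_mem_Icc.2 (gridPoint_mono hγ.lt.le n i.le_succ))))
    (coneAngle a γ (gridPoint a b n i)) (coneAngle a γ (gridPoint a b n (i + 1)))
  refine eq_of_tendsto_of_le_add hγ.tendsto_sum_surface_separators
    hu'.tendsto_sum_surface_separators hε (fun n => ?_) (fun n => ?_)
  all_goals
    rw [ENNReal.ofReal_sum_of_nonneg fun i _ => by positivity, Finset.mul_sum,
      ← Finset.sum_add_distrib]
    refine Finset.sum_le_sum fun i hi => ?_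
    simp only [planeInclusion_unfolding]
  · exact (hle n i hi).1
  · exact (hle n i hi).2

end Unfolding

end ConeUnfolding

theorem mainTheorem7 (a b : ℝ) (γ : ℝ → ConeUnfolding.Space)
    (hγ : ConeUnfolding.IsRectifiableCurve a b γ)
    (h0 : ∀ t ∈ Set.Icc a b, γ t ≠ 0) :
    ConeUnfolding.IsRectifiableCurve a b (ConeUnfolding.unfolding a γ) ∧
    (∀ t ∈ Set.Icc a b, ‖ConeUnfolding.unfolding a γ t‖ = ‖γ t‖) ∧
    (∀ s ∈ Set.Icc a b, ∀ t ∈ Set.Icc a b, s ≤ t →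
      ConeUnfolding.length s t (ConeUnfolding.unfolding a γ) = ConeUnfolding.length s t γ) ∧
    ConeUnfolding.efficiency a b γ =
      ConeUnfolding.efficiency a b
        (fun t => ConeUnfolding.planeInclusion (ConeUnfolding.unfolding a γ t)) := by
  refine ⟨hγ.unfolding h0, fun t _ => ConeUnfolding.norm_unfolding a γ t,
    fun s hs t ht hst => ConeUnfolding.length_unfolding hγ h0 hs ht hst, ?_⟩
  rw [ConeUnfolding.efficiency, ConeUnfolding.efficiency, ConeUnfolding.length_planeInclusion,
    ConeUnfolding.horizon_unfolding hγ h0, ConeUnfolding.length_unfolding hγ h0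
      (left_mem_Icc.2 hγ.lt.le) (right_mem_Icc.2 hγ.lt.le) hγ.lt.le]
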